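/- Let $n\ge 0$, $k\ge 1$ and $0\le m\le k$ be integers. For $0\le r\le k$ let $A_r$ be the $01$-matrix indexed by the $k$-subsets of $\{1,\dots,n\}$ with $(A_r)_{u,v}=1$ if and only if $|u\setminus v|=r$ (the matrices of the Johnson scheme $\mathcal J(n,k)$; $A_0=I$). Let $w_0,\dots,w_m$ be real numbers, let $X$ be the real-weighted graph with weighted adjacency matrix $A(X)=\sum_{r=0}^m w_rA_r$, and let $\tau\neq 0$ be real. Say that $X$ has perfect state transfer at time $\tau$ if there are two distinct vertices $u\ne v$ with $|U(\tau)_{u,v}|=1$, where $U(t)=\exp(-itA(X))$. Then $X$ has perfect state transfer at time $\tau$ if and only if all of the following hold: 1. $n=2k$; 2. $m\ge 2^{\lfloor\log_2 k\rfloor}$; 3. there are integers $c_1,\dots,c_m$ such that, for $j=1,\dots,m$, $c_j$ is odd if and only if $j$ is a power of $2$ (including $1=2^0$), and, for $r=1,\dots,m$, $$w_r=\frac{\pi}{\tau}\sum_{j=r}^{m}\frac{c_j}{\binom{2j}{j}}\binom{k-r}{j-r}.$$ -/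

import Mathlib

/-- The vertices of the Johnson scheme `J(n,k)`: the `k`-subsets of an `n`-set. -/
abbrev JohnsonVertex (n k : ℕ) : Type := {s : Finset (Fin n) // s.card = k}

/-- The adjacency matrix `A_r` of the generalized Johnson graph `J(n,k,r)`: two `k`-subsets are
adjacent when they differ in exactly `r` elements. In particular `A_0` is the identity. -/
def johnsonAdj (n k r : ℕ) : Matrix (JohnsonVertex n k) (JohnsonVertex n k) ℝ :=
  Matrix.of fun u v => if (u.1 \ v.1).card = r then 1 else 0

/-- The weighted adjacency matrix `A(X) = w_0 A_0 + w_1 A_1 + ⋯ + w_m A_m` of a real-weighted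
graph `X` of the Johnson scheme `J(n,k)`. -/
noncomputable def johnsonWeightedAdj (n k m : ℕ) (w : ℕ → ℝ) :
    Matrix (JohnsonVertex n k) (JohnsonVertex n k) ℝ :=
  ∑ r ∈ Finset.range (m + 1), w r • johnsonAdj n k r

/-- The transition matrix `U(t) = exp(-itA)` of the continuous-time quantum walk on the
real-weighted graph with weighted adjacency matrix `A`. -/
noncomputable def quantumWalk {V : Type*} [Fintype V] [DecidableEq V]
    (A : Matrix V V ℝ) (t : ℝ) : Matrix V V ℂ :=
  NormedSpace.exp ((-(Complex.I * (t : ℂ))) • A.map Complex.ofReal)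

/-- The real-weighted graph with weighted adjacency matrix `A` has perfect state transfer at
time `τ`: there are two distinct vertices `u`, `v` with `|U(τ)_{uv}| = 1`. -/
def HasPerfectStateTransferAt {V : Type*} [Fintype V] [DecidableEq V]
    (A : Matrix V V ℝ) (τ : ℝ) : Prop :=
  ∃ u v : V, u ≠ v ∧ ‖quantumWalk A τ u v‖ = 1

/-! A unitary matrix with an entry of modulus one has no other nonzero entry in that row. Since U(τ)
is invariant under the symmetric group, the target v is fixed by the stabiliser of u; hence v is the
complement of u and n = 2k. Perfect state transfer then means that U(τ) is a multiple of the
complement map, which acts as (-1)^s on the s-th eigenspace.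

Write A(X) = ∑ d_j B_j, where B_j has entries C(|u ∩ v|, k - j). On the eigenvectors built from
`pairSign`, with t = k - s, its eigenvalue is θ_t = ∑ d_j C(2j,j) C(t+j,2j). With c_j = (τ/π) d_j
C(2j,j), the condition becomes ∑_{j≥1} c_j C(t+j,2j) ≡ t modulo 2ℤ for all t ≤ k. This system is
unitriangular, so its solution in ℝ/2ℤ is unique, and the indicator of the powers of two solves it,
by Lucas's theorem and a telescoping sum. As c_j = 0 for j > m, no power of two may lie in (m, k]:
this is the bound on m. The weight w_0 is free because it only shifts the spectrum. -/

/-! ### Parity of binomial coefficients and powers of two. -/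

theorem Nat.choose_two_pow_modEq_div (b : ℕ) : ∀ N : ℕ, N.choose (2 ^ b) ≡ N / 2 ^ b [MOD 2] := by
  have : Fact (Nat.Prime 2) := ⟨Nat.prime_two⟩
  induction b with
  | zero => intro N; simp [Nat.ModEq]
  | succ b ih =>
    intro N
    -- Lucas's theorem strips the last binary digit of both entries; that of 2^(b+1) is zero and
    -- contributes the factor 1.
    have h := Choose.choose_modEq_choose_mod_mul_choose_div_nat (n := N) (k := 2 ^ (b + 1)) (p := 2)
    have h1 : 2 ^ (b + 1) % 2 = 0 := by rw [pow_succ]; exact Nat.mul_mod_left _ _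
    have h2 : 2 ^ (b + 1) / 2 = 2 ^ b := by rw [pow_succ]; exact Nat.mul_div_cancel _ two_pos
    rw [h1, h2, Nat.choose_zero_right, one_mul] at h
    refine h.trans ((ih _).trans ?_)
    rw [Nat.div_div_eq_div_mul, pow_succ, mul_comm]

/-- With q = ⌊t/2^a⌋ the a-th term is ⌈q/2⌉ = q - ⌊q/2⌋, so the sum telescopes. -/
theorem Nat.sum_add_two_pow_div_two_pow_succ (t L : ℕ) :
    ∑ a ∈ Finset.range L, (t + 2 ^ a) / 2 ^ (a + 1) + t / 2 ^ L = t := by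
  induction L with
  | zero => simp
  | succ L ih =>
    rw [Finset.sum_range_succ]
    have h1 : (t + 2 ^ L) / 2 ^ (L + 1) = (t / 2 ^ L + 1) / 2 := by
      rw [pow_succ, ← Nat.div_div_eq_div_mul, Nat.add_div_right _ (by positivity)]
    have h2 : t / 2 ^ (L + 1) = t / 2 ^ L / 2 := by
      rw [pow_succ, ← Nat.div_div_eq_div_mul]
    rw [h1, h2]
    omega

theorem Nat.sum_two_pow_choose_modEq (t : ℕ) :
    ∑ a ∈ Finset.range t, (t + 2 ^ a).choose (2 * 2 ^ a) ≡ t [MOD 2] := by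
  have h1 : ∑ a ∈ Finset.range t, (t + 2 ^ a).choose (2 * 2 ^ a) ≡
      ∑ a ∈ Finset.range t, (t + 2 ^ a) / 2 ^ (a + 1) [MOD 2] := by
    refine Nat.ModEq.sum fun a _ => ?_
    rw [← pow_succ']
    exact Nat.choose_two_pow_modEq_div _ _
  have h2 := Nat.sum_add_two_pow_div_two_pow_succ t t
  rw [Nat.div_eq_of_lt t.lt_two_pow_self, add_zero] at h2
  rwa [h2] at h1

open Classical in
/-- The indicator function of the powers of two. -/
noncomputable def twoPowIndicator (j : ℕ) : ℕ := if ∃ a : ℕ, j = 2 ^ a then 1 else 0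

theorem twoPowIndicator_zero : twoPowIndicator 0 = 0 := by
  rw [twoPowIndicator, if_neg]
  rintro ⟨a, ha⟩
  exact (pow_pos two_pos a).ne ha

theorem odd_twoPowIndicator_iff (j : ℕ) : Odd (twoPowIndicator j) ↔ ∃ a : ℕ, j = 2 ^ a := by
  unfold twoPowIndicator
  split_ifs with h <;> simp [h]

theorem twoPowIndicator_eq_sum {j t : ℕ} (hj : j ≤ t) :
    twoPowIndicator j = ∑ a ∈ Finset.range t, if j = 2 ^ a then 1 else 0 := by
  unfold twoPowIndicator
  split_ifs with h
  · obtain ⟨a, rfl⟩ := h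
    simp only [Nat.pow_right_inj one_lt_two]
    rw [Finset.sum_ite_eq, if_pos]
    exact Finset.mem_range.2 (a.lt_two_pow_self.trans_le hj)
  · rw [Finset.sum_eq_zero]
    intro a _
    rw [if_neg fun h' => h ⟨a, h'⟩]

/-- This is the particular solution of the parity system; its uniqueness comes from
unitriangularity. -/
theorem sum_twoPowIndicator_mul_choose_modEq (t : ℕ) :
    ∑ j ∈ Finset.range (t + 1), twoPowIndicator j * (t + j).choose (2 * j) ≡ t [MOD 2] := by
  have h : ∑ j ∈ Finset.range (t + 1), twoPowIndicator j * (t + j).choose (2 * j) =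
      ∑ a ∈ Finset.range t, (t + 2 ^ a).choose (2 * 2 ^ a) := by
    have h1 : ∀ j ∈ Finset.range (t + 1), twoPowIndicator j * (t + j).choose (2 * j) =
        ∑ a ∈ Finset.range t, if j = 2 ^ a then (t + j).choose (2 * j) else 0 := by
      intro j hj
      rw [twoPowIndicator_eq_sum (Finset.mem_range_succ_iff.1 hj), Finset.sum_mul]
      exact Finset.sum_congr rfl fun a _ => by split_ifs <;> simp
    rw [Finset.sum_congr rfl h1, Finset.sum_comm]
    refine Finset.sum_congr rfl fun a _ => ?_
    rw [Finset.sum_ite_eq']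
    split_ifs with h2
    · rfl
    · rw [Nat.choose_eq_zero_of_lt]
      rw [Finset.mem_range] at h2
      omega
  rw [h]
  exact Nat.sum_two_pow_choose_modEq t

/-! ### Unitriangular binomial systems. -/

/-- The system with coefficients `C(t+j, 2j)` is unitriangular, so membership of the right-hand
sides in an additive subgroup passes to the unknowns. -/
theorem AddSubgroup.mem_of_sum_choose_nsmul_mem {G : Type*} [AddCommGroup G] (H : AddSubgroup G)
    (e : ℕ → G) (k : ℕ)
    (h : ∀ t ≤ k, ∑ j ∈ Finset.range (k + 1), (t + j).choose (2 * j) • e j ∈ H) :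
    ∀ t ≤ k, e t ∈ H := by
  intro t
  induction t using Nat.strong_induction_on with
  | _ t ih =>
    intro ht
    have h1 := h t ht
    rw [← Finset.sum_subset (Finset.range_mono (Nat.succ_le_succ ht)), Finset.sum_range_succ,
      ← two_mul, Nat.choose_self, one_nsmul] at h1
    · refine (H.add_mem_cancel_left (H.sum_mem fun j hj => ?_)).1 h1
      have hj' := Finset.mem_range.1 hj
      exact H.nsmul_mem (ih j hj' (hj'.le.trans ht)) _
    · intro j _ hj
      rw [Finset.mem_range] at hj
      rw [Nat.choose_eq_zero_of_lt (by omega), zero_nsmul]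

/-- The system with coefficients `C(k-r, k-j)` is unitriangular. -/
theorem exists_sum_mul_choose_sub {R : Type*} [CommRing R] (k m : ℕ) (hmk : m ≤ k) (w : ℕ → R) :
    ∃ d : ℕ → R, ∀ r ≤ k, (if r ≤ m then w r else 0) =
      ∑ j ∈ Finset.range (m + 1), d j * ((k - r).choose (k - j) : R) := by
  induction m generalizing w with
  | zero =>
    refine ⟨fun _ => w 0, fun r hr => ?_⟩
    rcases Nat.eq_zero_or_pos r with rfl | h
    · simp
    · rw [if_neg (by omega), Finset.sum_range_one, Nat.choose_eq_zero_of_lt (by omega)]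
      simp
  | succ m ih =>
    -- Column m + 1 vanishes for r > m + 1 and is 1 at r = m + 1, so its coefficient must be w (m +
    -- 1); subtracting it leaves a system of size m.
    obtain ⟨d, hd⟩ := ih (by omega) fun r =>
      w r - w (m + 1) * ((k - r).choose (k - (m + 1)) : R)
    refine ⟨Function.update d (m + 1) (w (m + 1)), fun r hr => ?_⟩
    rw [Finset.sum_range_succ, Function.update_self]
    have h1 : ∑ j ∈ Finset.range (m + 1), Function.update d (m + 1) (w (m + 1)) j *
        ((k - r).choose (k - j) : R) = ∑ j ∈ Finset.range (m + 1), d j *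
        ((k - r).choose (k - j) : R) := by
      refine Finset.sum_congr rfl fun j hj => ?_
      rw [Function.update_of_ne (Finset.mem_range.1 hj).ne]
    rw [h1, ← hd r hr]
    rcases lt_trichotomy r (m + 1) with h | rfl | h
    · rw [if_pos h.le, if_pos (by omega)]; ring
    · rw [if_pos le_rfl, if_neg (by omega)]; simp
    · rw [if_neg (by omega), if_neg (by omega), Nat.choose_eq_zero_of_lt (by omega)]; simp

/-- The left side is the eigenvalue as it arises from inclusion matrices. The right side isolates a
factor free of t, leaving C(t+j,2j), which is 1 at j = t and 0 for j > t. -/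
theorem Nat.choose_mul_choose_add (t j : ℕ) :
    t.choose j * (t + j).choose j = (2 * j).choose j * (t + j).choose (2 * j) := by
  have h := Nat.choose_mul (n := t + j) (k := 2 * j) (s := j) (by omega)
  rw [Nat.add_sub_cancel, two_mul, Nat.add_sub_cancel, ← two_mul] at h
  rw [mul_comm, ← h, mul_comm]

theorem sum_Icc_choose_eq_sum_range {R : Type*} [CommRing R] {k m : ℕ} (hmk : m ≤ k) (d : ℕ → R)
    {r : ℕ} (hr : r ≤ m) :
    ∑ j ∈ Finset.range (m + 1), d j * ((k - r).choose (k - j) : R) =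
      ∑ j ∈ Finset.Icc r m, d j * ((k - r).choose (j - r) : R) := by
  rw [← Finset.sum_subset (s₁ := Finset.Icc r m) (s₂ := Finset.range (m + 1))]
  · refine Finset.sum_congr rfl fun j hj => ?_
    rw [Finset.mem_Icc] at hj
    rw [← Nat.choose_symm (n := k - r) (k := k - j) (by omega)]
    congr 3
    omega
  · intro j hj
    rw [Finset.mem_Icc] at hj
    rw [Finset.mem_range]
    omega
  · intro j hj hj'
    rw [Finset.mem_range] at hj
    rw [Finset.mem_Icc] at hj'
    rw [Nat.choose_eq_zero_of_lt (by omega)]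
    simp

/-! ### Eigenvectors from signed pairs. -/

/-- The product over all pairs `{a i, b i}` of the signed indicator of the pair in `u`. For
disjoint pairs these functions are eigenvectors of the Johnson scheme. -/
def pairSign {ι α : Type*} [Fintype ι] [DecidableEq α] (a b : ι → α) (u : Finset α) : ℂ :=
  ∏ i, ((if a i ∈ u then 1 else 0) - (if b i ∈ u then 1 else 0))

section PairSign

variable {ι α : Type*} [Fintype ι] [DecidableEq α] {a b : ι → α}

theorem pairSign_eq_zero {u : Finset α} (i : ι) (h : a i ∈ u ↔ b i ∈ u) : pairSign a b u = 0 := by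
  refine Finset.prod_eq_zero (Finset.mem_univ i) ?_
  simp [h]

theorem pairSign_congr {u z : Finset α} (ha : ∀ i, a i ∈ u ↔ a i ∈ z)
    (hb : ∀ i, b i ∈ u ↔ b i ∈ z) : pairSign a b u = pairSign a b z := by
  unfold pairSign
  simp only [ha, hb]

/-- Complementation negates every factor. The sign turns sums over supersets into sums over subsets,
and is also the eigenvalue of the complement map. -/
theorem pairSign_compl [Fintype α] (u : Finset α) :
    pairSign a b uᶜ = (-1) ^ Fintype.card ι * pairSign a b u := by
  unfold pairSign
  rw [← Finset.card_univ, ← Finset.prod_const, ← Finset.prod_mul_distrib]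
  refine Finset.prod_congr rfl fun i _ => ?_
  by_cases h1 : a i ∈ u <;> by_cases h2 : b i ∈ u <;> simp [h1, h2]

theorem pairSign_map_swap (ha : Function.Injective a) (hb : Function.Injective b)
    (hab : ∀ i j, a i ≠ b j) (i : ι) (u : Finset α) :
    pairSign a b (u.map (Equiv.swap (a i) (b i)).toEmbedding) = -pairSign a b u := by
  classical
  unfold pairSign
  rw [← Finset.mul_prod_erase _ _ (Finset.mem_univ i),
    ← Finset.mul_prod_erase Finset.univ
      (fun i => ((if a i ∈ u then (1 : ℂ) else 0) - (if b i ∈ u then 1 else 0)))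
      (Finset.mem_univ i), ← neg_mul]
  congr 1
  · simp [Finset.mem_map_equiv]
  · refine Finset.prod_congr rfl fun j hj => ?_
    have hj' := Finset.ne_of_mem_erase hj
    simp only [Finset.mem_map_equiv, Equiv.symm_swap,
      Equiv.swap_apply_of_ne_of_ne (ha.ne hj') (hab j i),
      Equiv.swap_apply_of_ne_of_ne (hab i j).symm (hb.ne hj')]

/-- Swapping the two points of the pair permutes the l-subsets of u and negates the summand. -/
theorem sum_powersetCard_pairSign_of_pair_subset (ha : Function.Injective a)
    (hb : Function.Injective b) (hab : ∀ i j, a i ≠ b j) (i : ι) {u : Finset α} (hau : a i ∈ u)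
    (hbu : b i ∈ u) (l : ℕ) : ∑ z ∈ u.powersetCard l, pairSign a b z = 0 := by
  rw [← self_eq_neg, ← Finset.sum_neg_distrib]
  let σ := Equiv.swap (a i) (b i)
  have hσ : ∀ x ∈ u, σ x ∈ u := by
    intro x hx
    by_cases h1 : x = a i
    · rw [h1, Equiv.swap_apply_left]; exact hbu
    by_cases h2 : x = b i
    · rw [h2, Equiv.swap_apply_right]; exact hau
    rw [Equiv.swap_apply_of_ne_of_ne h1 h2]; exact hx
  have hmem : ∀ z ∈ u.powersetCard l, z.map σ.toEmbedding ∈ u.powersetCard l := by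
    intro z hz
    rw [Finset.mem_powersetCard] at hz ⊢
    refine ⟨fun x hx => ?_, by rw [Finset.card_map]; exact hz.2⟩
    obtain ⟨y, hy, rfl⟩ := Finset.mem_map.1 hx
    exact hσ y (hz.1 hy)
  have hinv : ∀ z : Finset α, (z.map σ.toEmbedding).map σ.toEmbedding = z := by
    intro z
    ext x
    simp [Finset.mem_map_equiv, σ]
  refine Finset.sum_bij' (fun z _ => z.map σ.toEmbedding) (fun z _ => z.map σ.toEmbedding) hmem hmem
    (fun z _ => hinv z) (fun z _ => hinv z) fun z _ => ?_
  rw [pairSign_map_swap ha hb hab, neg_neg]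

/-- If u meets each pair in one point, forming a transversal T, then only the z containing T
contribute, each with the same sign as u. Counting the removed set u \ z gives a binomial that is
correctly 0 when l is below the number of pairs. -/
theorem sum_powersetCard_pairSign (ha : Function.Injective a) (hb : Function.Injective b)
    (hab : ∀ i j, a i ≠ b j) (u : Finset α) {l : ℕ} (hl : l ≤ u.card) :
    ∑ z ∈ u.powersetCard l, pairSign a b z =
      ((u.card - Fintype.card ι).choose (u.card - l) : ℂ) * pairSign a b u := by
  by_cases h : ∃ i, (a i ∈ u ↔ b i ∈ u)
  · obtain ⟨i, hi⟩ := h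
    rw [pairSign_eq_zero i hi, mul_zero]
    by_cases hau : a i ∈ u
    · exact sum_powersetCard_pairSign_of_pair_subset ha hb hab i hau (hi.1 hau) l
    · refine Finset.sum_eq_zero fun z hz => pairSign_eq_zero i ?_
      have hz' := (Finset.mem_powersetCard.1 hz).1
      exact iff_of_false (fun h => hau (hz' h)) fun h => hau (hi.2 (hz' h))
  push Not at h
  let f : ι → α := fun i => if a i ∈ u then a i else b i
  have hf : Function.Injective f := by
    intro i j hij
    simp only [f] at hij
    split_ifs at hij
    · exact ha hij
    · exact absurd hij (hab _ _)
    · exact absurd hij.symm (hab _ _)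
    · exact hb hij
  let T : Finset α := Finset.univ.map ⟨f, hf⟩
  have hTmem : ∀ i, f i ∈ T := fun i => Finset.mem_map_of_mem ⟨f, hf⟩ (Finset.mem_univ i)
  have hfu : ∀ i, f i ∈ u := by
    intro i
    simp only [f]
    split_ifs with h1
    · exact h1
    · rcases h i with h2 | h2
      · exact absurd h2.1 h1
      · exact h2.2
  have hTu : T ⊆ u := by
    intro x hx
    obtain ⟨i, _, rfl⟩ := Finset.mem_map.1 hx
    exact hfu i
  have hTcard : T.card = Fintype.card ι := Finset.card_map _
  have hsum : ∑ z ∈ u.powersetCard l, pairSign a b z =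
      ∑ z ∈ (u \ T).powersetCard (u.card - l), pairSign a b u := by
    symm
    refine Finset.sum_of_injOn (fun z => u \ z) ?_ ?_ ?_ ?_
    · intro z hz z' hz' hzz
      have h1 := (Finset.mem_powersetCard.1 hz).1.trans Finset.sdiff_subset
      have h2 := (Finset.mem_powersetCard.1 hz').1.trans Finset.sdiff_subset
      rw [← Finset.sdiff_sdiff_eq_self h1, ← Finset.sdiff_sdiff_eq_self h2]
      exact congrArg (u \ ·) hzz
    · intro z hz
      have hz' := Finset.mem_powersetCard.1 hz
      refine Finset.mem_powersetCard.2 ⟨Finset.sdiff_subset, ?_⟩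
      rw [Finset.card_sdiff_of_subset (hz'.1.trans Finset.sdiff_subset), hz'.2]
      omega
    · intro z hz hz'
      obtain ⟨hzu, hzc⟩ := Finset.mem_powersetCard.1 hz
      have hT : ¬ T ⊆ z := by
        intro hT
        refine hz' ⟨u \ z, Finset.mem_powersetCard.2 ⟨?_, ?_⟩, Finset.sdiff_sdiff_eq_self hzu⟩
        · exact Finset.sdiff_subset_sdiff le_rfl hT
        · rw [Finset.card_sdiff_of_subset hzu, hzc]
      obtain ⟨x, hxT, hxz⟩ := Finset.not_subset.1 hT
      obtain ⟨i, _, rfl⟩ := Finset.mem_map.1 hxT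
      refine pairSign_eq_zero i ?_
      simp only [Function.Embedding.coeFn_mk, f] at hxz
      have := h i
      have h1 := @hzu (a i)
      have h2 := @hzu (b i)
      split_ifs at hxz <;> tauto
    · intro z hz
      have hz' := (Finset.mem_powersetCard.1 hz).1
      have key : ∀ i, f i ∉ z := fun i hi => (Finset.mem_sdiff.1 (hz' hi)).2 (hTmem i)
      have hz'' := hz'.trans Finset.sdiff_subset
      refine pairSign_congr (fun i => ?_) fun i => ?_
      all_goals
        have h0 := key i
        have := h i
        simp only [f] at h0
        rw [Finset.mem_sdiff]
        split_ifs at h0 <;> tauto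
  rw [hsum, Finset.sum_const, Finset.card_powersetCard, Finset.card_sdiff_of_subset hTu, hTcard,
    nsmul_eq_mul]

theorem sum_superset_pairSign [Fintype α] (ha : Function.Injective a) (hb : Function.Injective b)
    (hab : ∀ i j, a i ≠ b j) (z : Finset α) {k : ℕ} (hz : z.card ≤ k) (hk : k ≤ Fintype.card α) :
    ∑ u ∈ (Finset.univ.powersetCard k).filter (z ⊆ ·), pairSign a b u =
      ((Fintype.card α - z.card - Fintype.card ι).choose (k - z.card) : ℂ) * pairSign a b z := by
  have h := sum_powersetCard_pairSign ha hb hab zᶜ (l := Fintype.card α - k)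
    (by rw [Finset.card_compl]; omega)
  rw [Finset.card_compl, pairSign_compl] at h
  have h2 : ∑ u ∈ (Finset.univ.powersetCard k).filter (z ⊆ ·), pairSign a b u =
      (-1) ^ Fintype.card ι * ∑ u ∈ zᶜ.powersetCard (Fintype.card α - k), pairSign a b u := by
    rw [Finset.mul_sum]
    refine Finset.sum_bij' (fun u _ => uᶜ) (fun u _ => uᶜ) ?_ ?_ ?_ ?_ ?_
    · intro u hu
      rw [Finset.mem_filter, Finset.mem_powersetCard] at hu
      rw [Finset.mem_powersetCard, Finset.card_compl, hu.1.2]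
      exact ⟨Finset.compl_subset_compl.2 hu.2, rfl⟩
    · intro u hu
      rw [Finset.mem_powersetCard] at hu
      rw [Finset.mem_filter, Finset.mem_powersetCard, Finset.card_compl, hu.2]
      exact ⟨⟨Finset.subset_univ _, by omega⟩, Finset.subset_compl_comm.1 hu.1⟩
    · simp
    · simp
    · intro u _
      rw [pairSign_compl, ← mul_assoc, ← mul_pow]
      simp
  rw [h2, h, show Fintype.card α - z.card - (Fintype.card α - k) = k - z.card by omega,
    mul_left_comm, ← mul_assoc ((-1 : ℂ) ^ Fintype.card ι) _ (pairSign a b z), ← mul_pow]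
  simp

/-- The functions `pairSign` are eigenvectors of the products of inclusion matrices. -/
theorem sum_choose_inter_mul_pairSign [Fintype α] (ha : Function.Injective a)
    (hb : Function.Injective b) (hab : ∀ i j, a i ≠ b j) {k l : ℕ} (hl : l ≤ k)
    (hk : k ≤ Fintype.card α) (u : Finset α) (hu : u.card = k) :
    ∑ v ∈ Finset.univ.powersetCard k, ((u ∩ v).card.choose l : ℂ) * pairSign a b v =
      ((k - Fintype.card ι).choose (k - l) *
        (Fintype.card α - l - Fintype.card ι).choose (k - l) : ℕ) * pairSign a b u := by
  -- The binomial counts the l-subsets z of u lying in v; exchanging the sums factors the matrix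
  -- through l-subsets.
  have h1 : ∀ v : Finset α, ((u ∩ v).card.choose l : ℂ) * pairSign a b v =
      ∑ z ∈ u.powersetCard l, if z ⊆ v then pairSign a b v else 0 := by
    intro v
    rw [← Finset.sum_filter, Finset.sum_const, nsmul_eq_mul, ← Finset.card_powersetCard]
    congr 3
    ext z
    simp only [Finset.mem_powersetCard, Finset.mem_filter, Finset.subset_inter_iff]
    tauto
  simp_rw [h1]
  rw [Finset.sum_comm]
  have h2 : ∀ z ∈ u.powersetCard l,
      (∑ v ∈ Finset.univ.powersetCard k, if z ⊆ v then pairSign a b v else 0) =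
      ((Fintype.card α - l - Fintype.card ι).choose (k - l) : ℂ) * pairSign a b z := by
    intro z hz
    have hz' := (Finset.mem_powersetCard.1 hz).2
    rw [← Finset.sum_filter, sum_superset_pairSign ha hb hab z (hz'.trans_le hl) hk, hz']
  rw [Finset.sum_congr rfl h2, ← Finset.mul_sum,
    sum_powersetCard_pairSign ha hb hab u (hl.trans hu.ge), hu]
  push_cast
  ring

end PairSign

/-! ### Matrix exponentials and unitarity of the walk. -/

section MatrixExp

variable {V : Type*} [Fintype V] [DecidableEq V]

open scoped Matrix.Norms.Operator in
theorem Matrix.exp_mulVec_of_mulVec_eq_smul (M : Matrix V V ℂ) (v : V → ℂ) (θ : ℂ)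
    (h : M.mulVec v = θ • v) : (NormedSpace.exp M).mulVec v = Complex.exp θ • v := by
  -- All columns of X equal v, so the eigenvector equation says that X intertwines the scalar θ with
  -- M, and intertwining passes to exponentials.
  let X : Matrix V V ℂ := Matrix.of fun i _ => v i
  have hX : ∀ N : Matrix V V ℂ, N * X = Matrix.of fun i _ => N.mulVec v i := fun N => rfl
  have h1 : SemiconjBy X (algebraMap ℂ (Matrix V V ℂ) θ) M := by
    change X * _ = M * X
    rw [hX, h, ← Algebra.commutes, ← Algebra.smul_def]
    rfl
  have h2 := h1.exp_right
  change X * _ = _ * X at h2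
  rw [hX, ← NormedSpace.algebraMap_exp_comm, ← Algebra.commutes, ← Algebra.smul_def,
    ← Complex.exp_eq_exp_ℂ] at h2
  ext i
  exact (congrFun (congrFun h2 i) i).symm

/-- The invariant matrices form a closed subalgebra, which therefore contains the exponentials of
its elements. -/
theorem Matrix.exp_apply_perm (M : Matrix V V ℂ) (e : Equiv.Perm V)
    (h : ∀ u v, M (e u) (e v) = M u v) (u v : V) :
    NormedSpace.exp M (e u) (e v) = NormedSpace.exp M u v := by
  let S : Subalgebra ℂ (Matrix V V ℂ) :=
    { carrier := {N | ∀ u v, N (e u) (e v) = N u v}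
      mul_mem' := fun {N P} hN hP u v => by
        rw [Matrix.mul_apply, Matrix.mul_apply, ← Equiv.sum_comp e]
        exact Finset.sum_congr rfl fun w _ => by rw [hN, hP]
      add_mem' := fun {N P} hN hP u v => by
        rw [Matrix.add_apply, Matrix.add_apply, hN, hP]
      algebraMap_mem' := fun r u v => by
        simp [Matrix.algebraMap_matrix_apply] }
  have hS : IsClosed (S : Set (Matrix V V ℂ)) := by
    change IsClosed {N : Matrix V V ℂ | ∀ u v, N (e u) (e v) = N u v}
    simp only [Set.ofPred_forall]
    exact isClosed_iInter fun u => isClosed_iInter fun v =>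
      isClosed_eq (continuous_id.matrix_elem _ _) (continuous_id.matrix_elem _ _)
  exact NormedSpace.exp_mem hS (show M ∈ S from h) u v

theorem quantumWalk_mul_conjTranspose (A : Matrix V V ℝ) (hA : A.IsSymm) (t : ℝ) :
    quantumWalk A t * (quantumWalk A t).conjTranspose = 1 := by
  unfold quantumWalk
  have h : ((-(Complex.I * (t : ℂ))) • A.map Complex.ofReal).conjTranspose =
      -((-(Complex.I * (t : ℂ))) • A.map Complex.ofReal) := by
    ext i j
    simp [hA.apply i j]
  rw [← Matrix.exp_conjTranspose, h, Matrix.exp_neg]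
  exact Matrix.mul_nonsing_inv _ ((Matrix.isUnit_iff_isUnit_det _).1 (Matrix.isUnit_exp _))

theorem sum_norm_sq_quantumWalk (A : Matrix V V ℝ) (hA : A.IsSymm) (t : ℝ) (u : V) :
    ∑ v, ‖quantumWalk A t u v‖ ^ 2 = 1 := by
  have h := congrFun (congrFun (quantumWalk_mul_conjTranspose A hA t) u) u
  rw [Matrix.mul_apply, Matrix.one_apply_eq] at h
  have h2 : ∀ v, quantumWalk A t u v * (quantumWalk A t).conjTranspose v u =
      ((‖quantumWalk A t u v‖ ^ 2 : ℝ) : ℂ) := by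
    intro v
    rw [Matrix.conjTranspose_apply, ← starRingEnd_apply, Complex.mul_conj, Complex.normSq_eq_norm_sq]
  simp_rw [h2] at h
  exact_mod_cast h

theorem quantumWalk_eq_zero_of_norm_eq_one (A : Matrix V V ℝ) (hA : A.IsSymm) (t : ℝ) {u v w : V}
    (h : ‖quantumWalk A t u v‖ = 1) (hw : w ≠ v) : quantumWalk A t u w = 0 := by
  have h1 := sum_norm_sq_quantumWalk A hA t u
  rw [← Finset.add_sum_erase _ _ (Finset.mem_univ v), h] at h1
  have h2 : ∑ x ∈ Finset.univ.erase v, ‖quantumWalk A t u x‖ ^ 2 = 0 := by linarith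
  rw [Finset.sum_eq_zero_iff_of_nonneg fun _ _ => by positivity] at h2
  have h3 := h2 w (Finset.mem_erase.2 ⟨hw, Finset.mem_univ w⟩)
  exact norm_eq_zero.1 (pow_eq_zero_iff two_ne_zero |>.1 h3)

end MatrixExp

/-! ### The symmetric group action, and where transfer can go. -/

namespace JohnsonVertex

variable {n k : ℕ}

/-- The action of a permutation of the ground set on the vertices of the Johnson scheme. -/
def perm (σ : Equiv.Perm (Fin n)) : Equiv.Perm (JohnsonVertex n k) where
  toFun u := ⟨u.1.map σ.toEmbedding, by rw [Finset.card_map]; exact u.2⟩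
  invFun u := ⟨u.1.map σ.symm.toEmbedding, by rw [Finset.card_map]; exact u.2⟩
  left_inv u := by ext; simp [Finset.mem_map_equiv]
  right_inv u := by ext; simp [Finset.mem_map_equiv]

theorem mem_perm (σ : Equiv.Perm (Fin n)) (u : JohnsonVertex n k) (x : Fin n) :
    σ x ∈ (perm σ u).1 ↔ x ∈ u.1 := by
  simp [perm]

theorem perm_eq_iff (σ : Equiv.Perm (Fin n)) (u v : JohnsonVertex n k) :
    perm σ u = v ↔ ∀ x, x ∈ u.1 ↔ σ x ∈ v.1 := by
  constructor
  · rintro rfl x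
    exact (mem_perm σ u x).symm
  · intro h
    ext x
    obtain ⟨y, rfl⟩ := σ.surjective x
    rw [mem_perm, h]

theorem card_sdiff_perm (σ : Equiv.Perm (Fin n)) (u v : JohnsonVertex n k) :
    ((perm σ u).1 \ (perm σ v).1).card = (u.1 \ v.1).card := by
  simp only [perm, Equiv.coe_fn_mk]
  rw [← Finset.map_sdiff, Finset.card_map]

theorem card_inter_add (u v : JohnsonVertex n k) : (u.1 ∩ v.1).card + (u.1 \ v.1).card = k := by
  rw [Finset.card_inter_add_card_sdiff, u.2]

theorem card_sdiff_le (u v : JohnsonVertex n k) : (u.1 \ v.1).card ≤ k := by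
  have := card_inter_add u v
  omega

/-- The symmetric group acts transitively on the pairs of vertices at a given distance. -/
theorem exists_perm_eq (u v u' v' : JohnsonVertex n k)
    (h : (u.1 \ v.1).card = (u'.1 \ v'.1).card) :
    ∃ σ : Equiv.Perm (Fin n), perm σ u = u' ∧ perm σ v = v' := by
  -- Points are labelled by membership in the two sets. The distance fixes all four fibre sizes, so
  -- matching fibres gives the permutation.
  let f : JohnsonVertex n k → JohnsonVertex n k → Fin n → Bool × Bool :=
    fun u v x => (decide (x ∈ u.1), decide (x ∈ v.1))
  have hcard : ∀ c, Fintype.card {x // f u v x = c} = Fintype.card {x // f u' v' x = c} := by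
    have h1 := card_inter_add u v
    have h2 := card_inter_add u' v'
    have h3 := card_inter_add v u
    have h4 := card_inter_add v' u'
    have h5 := Finset.card_compl (u.1 ∪ v.1)
    have h6 := Finset.card_compl (u'.1 ∪ v'.1)
    have h7 := Finset.card_union_add_card_inter u.1 v.1
    have h8 := Finset.card_union_add_card_inter u'.1 v'.1
    rw [Finset.inter_comm] at h3 h4
    have := u.2
    have := u'.2
    have := v.2
    have := v'.2
    rintro ⟨c, d⟩
    have key : ∀ u v : JohnsonVertex n k, Fintype.card {x // f u v x = (c, d)} =
        (if c then (if d then (u.1 ∩ v.1).card else (u.1 \ v.1).card) else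
          (if d then (v.1 \ u.1).card else (u.1 ∪ v.1)ᶜ.card)) := by
      intro u v
      rw [Fintype.card_subtype]
      cases c <;> cases d <;> simp only [Bool.false_eq_true, if_true, if_false] <;> congr 1 <;>
        ext x <;> simp [f] <;> tauto
    rw [key, key]
    cases c <;> cases d <;> simp only [Bool.false_eq_true, if_true, if_false] <;> omega
  let σ : Equiv.Perm (Fin n) := Equiv.ofFiberEquiv fun c => Fintype.equivOfCardEq (hcard c)
  have hσ : ∀ x, f u' v' (σ x) = f u v x := fun x => Equiv.ofFiberEquiv_map _ x
  refine ⟨σ, ?_, ?_⟩ <;> rw [perm_eq_iff] <;> intro x <;> have := hσ x <;>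
    simp only [f, Prod.mk.injEq, decide_eq_decide] at this <;> tauto

end JohnsonVertex

theorem johnsonWeightedAdj_apply (n k m : ℕ) (w : ℕ → ℝ) (u v : JohnsonVertex n k) :
    johnsonWeightedAdj n k m w u v =
      if (u.1 \ v.1).card ≤ m then w (u.1 \ v.1).card else 0 := by
  simp [johnsonWeightedAdj, johnsonAdj, Matrix.sum_apply]

theorem johnsonWeightedAdj_isSymm (n k m : ℕ) (w : ℕ → ℝ) : (johnsonWeightedAdj n k m w).IsSymm := by
  ext u v
  rw [Matrix.transpose_apply, johnsonWeightedAdj_apply, johnsonWeightedAdj_apply]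
  have h1 := JohnsonVertex.card_inter_add u v
  have h2 := JohnsonVertex.card_inter_add v u
  rw [Finset.inter_comm] at h2
  rw [show (u.1 \ v.1).card = (v.1 \ u.1).card by omega]

theorem quantumWalk_johnson_perm (n k m : ℕ) (w : ℕ → ℝ) (τ : ℝ) (σ : Equiv.Perm (Fin n))
    (u v : JohnsonVertex n k) :
    quantumWalk (johnsonWeightedAdj n k m w) τ (JohnsonVertex.perm σ u) (JohnsonVertex.perm σ v) =
      quantumWalk (johnsonWeightedAdj n k m w) τ u v := by
  refine Matrix.exp_apply_perm _ _ (fun u v => ?_) u v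
  simp only [Matrix.smul_apply, Matrix.map_apply, johnsonWeightedAdj_apply,
    JohnsonVertex.card_sdiff_perm]

/-- Perfect state transfer forces the two vertices to be complementary. -/
theorem compl_eq_of_norm_quantumWalk_eq_one {n k m : ℕ} {w : ℕ → ℝ} {τ : ℝ}
    {u v : JohnsonVertex n k} (huv : u ≠ v)
    (h : ‖quantumWalk (johnsonWeightedAdj n k m w) τ u v‖ = 1) : v.1 = u.1ᶜ := by
  have hfix : ∀ σ : Equiv.Perm (Fin n), JohnsonVertex.perm σ u = u → JohnsonVertex.perm σ v = v := by
    intro σ hσ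
    by_contra hne
    have h1 := quantumWalk_eq_zero_of_norm_eq_one _ (johnsonWeightedAdj_isSymm n k m w) τ h hne
    have h2 := quantumWalk_johnson_perm n k m w τ σ u v
    rw [hσ, h1] at h2
    rw [← h2, norm_zero] at h
    exact zero_ne_one h
  have hne : u.1 ≠ v.1 := fun h => huv (Subtype.ext h)
  -- Transpositions inside u or inside its complement fix u, hence v, so v is a union of some of
  -- these two blocks.
  have hswap : ∀ x y, (x ∈ u.1 ↔ y ∈ u.1) → (x ∈ v.1 ↔ y ∈ v.1) := by
    intro x y hxy
    have h1 : JohnsonVertex.perm (Equiv.swap x y) u = u := by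
      rw [JohnsonVertex.perm_eq_iff]
      intro z
      by_cases hzx : z = x
      · rw [hzx, Equiv.swap_apply_left, hxy]
      by_cases hzy : z = y
      · rw [hzy, Equiv.swap_apply_right, hxy]
      rw [Equiv.swap_apply_of_ne_of_ne hzx hzy]
    have h2 := (JohnsonVertex.perm_eq_iff _ _ _).1 (hfix _ h1) x
    rwa [Equiv.swap_apply_left] at h2
  obtain ⟨x, hxu, hxv⟩ := Finset.not_subset.1 fun hs : u.1 ⊆ v.1 =>
    hne (Finset.eq_of_subset_of_card_le hs (by rw [u.2, v.2]))
  obtain ⟨y, hyv, hyu⟩ := Finset.not_subset.1 fun hs : v.1 ⊆ u.1 =>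
    hne (Finset.eq_of_subset_of_card_le hs (by rw [u.2, v.2])).symm
  ext z
  rw [Finset.mem_compl]
  by_cases hz : z ∈ u.1
  · have := hswap x z (by tauto)
    tauto
  · have := hswap y z (by tauto)
    tauto

/-! ### The scheme J(2k,k): complements and spectrum. -/

namespace JohnsonVertex

variable {k s : ℕ}

/-- The complement of a `k`-subset of a `2k`-set. -/
def compl (u : JohnsonVertex (2 * k) k) : JohnsonVertex (2 * k) k :=
  ⟨u.1ᶜ, by rw [Finset.card_compl, u.2, Fintype.card_fin]; omega⟩

theorem perm_compl (σ : Equiv.Perm (Fin (2 * k))) (u : JohnsonVertex (2 * k) k) :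
    perm σ u.compl = (perm σ u).compl := by
  rw [perm_eq_iff]
  intro x
  simp [compl, perm]

/-- The initial segment as a vertex of `J(2k,k)`. -/
def initial (k : ℕ) : JohnsonVertex (2 * k) k :=
  ⟨Finset.univ.map (Fin.castLEEmb (by omega : k ≤ 2 * k)), by simp⟩

theorem mem_initial (x : Fin (2 * k)) : x ∈ (initial k).1 ↔ (x : ℕ) < k := by
  simp only [initial, Finset.mem_map, Finset.mem_univ, true_and]
  constructor
  · rintro ⟨y, rfl⟩
    exact y.2
  · intro h
    exact ⟨⟨x, h⟩, rfl⟩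

/-- An eigenvector of the Johnson scheme `J(2k,k)` in its `s`-th eigenspace. -/
def eigenvector (hs : s ≤ k) (u : JohnsonVertex (2 * k) k) : ℂ :=
  pairSign (fun i : Fin s => (⟨i, by omega⟩ : Fin (2 * k)))
    (fun i : Fin s => (⟨k + i, by omega⟩ : Fin (2 * k))) u.1

/-- With this normalisation, evaluating an eigenvector equation at `initial k` reads off the
eigenvalue. -/
theorem eigenvector_initial (hs : s ≤ k) : eigenvector hs (initial k) = 1 := by
  unfold eigenvector pairSign
  refine Finset.prod_eq_one fun i _ => ?_
  simp only [mem_initial]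
  rw [if_pos (by omega), if_neg (by omega), sub_zero]

theorem eigenvector_compl (hs : s ≤ k) (u : JohnsonVertex (2 * k) k) :
    eigenvector hs u.compl = (-1) ^ s * eigenvector hs u := by
  unfold eigenvector compl
  rw [pairSign_compl, Fintype.card_fin]

theorem sum_choose_mul_eigenvector (hs : s ≤ k) {j : ℕ} (hj : j ≤ k)
    (u : JohnsonVertex (2 * k) k) :
    ∑ v, ((k - (u.1 \ v.1).card).choose (k - j) : ℂ) * eigenvector hs v =
      ((2 * j).choose j * (k - s + j).choose (2 * j) : ℕ) * eigenvector hs u := by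
  have h := sum_choose_inter_mul_pairSign
    (a := fun i : Fin s => (⟨i, by omega⟩ : Fin (2 * k)))
    (b := fun i : Fin s => (⟨k + i, by omega⟩ : Fin (2 * k)))
    (fun i j h => Fin.ext (by simpa using h)) (fun i j h => Fin.ext (by simpa using h))
    (fun i j h => by
      have := congrArg Fin.val h
      simp only at this
      omega)
    (Nat.sub_le k j) (by rw [Fintype.card_fin]; omega) u.1 u.2
  rw [Fintype.card_fin, Fintype.card_fin, show k - (k - j) = j by omega,
    show 2 * k - (k - j) - s = k - s + j by omega, Nat.choose_mul_choose_add] at h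
  unfold eigenvector
  rw [← h]
  symm
  rw [Finset.sum_subtype (p := fun v : Finset (Fin (2 * k)) => v.card = k) _ (by simp)]
  refine Finset.sum_congr rfl fun v _ => ?_
  have := card_inter_add u v
  rw [show (u.1 ∩ v.1).card = k - (u.1 \ v.1).card by omega]

theorem mulVec_eigenvector (hs : s ≤ k) {m : ℕ} (hmk : m ≤ k) (d : ℕ → ℂ)
    (M : Matrix (JohnsonVertex (2 * k) k) (JohnsonVertex (2 * k) k) ℂ)
    (hM : ∀ u v, M u v = ∑ j ∈ Finset.range (m + 1),
      d j * ((k - (u.1 \ v.1).card).choose (k - j) : ℂ)) :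
    M.mulVec (eigenvector hs) = (∑ j ∈ Finset.range (m + 1),
      d j * ((2 * j).choose j * (k - s + j).choose (2 * j) : ℕ)) • eigenvector hs := by
  ext u
  rw [Matrix.mulVec, dotProduct, Pi.smul_apply, smul_eq_mul, Finset.sum_mul]
  simp_rw [hM, Finset.sum_mul]
  rw [Finset.sum_comm]
  refine Finset.sum_congr rfl fun j hj => ?_
  simp_rw [mul_assoc]
  rw [← Finset.mul_sum,
    sum_choose_mul_eigenvector hs ((Finset.mem_range_succ_iff.1 hj).trans hmk)]

/-- A matrix in the Bose-Mesner algebra of `J(2k,k)` that kills all the eigenvectors vanishes. -/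
theorem eq_zero_of_mulVec_eigenvector
    (M : Matrix (JohnsonVertex (2 * k) k) (JohnsonVertex (2 * k) k) ℂ)
    (hM : ∀ σ u v, M (perm σ u) (perm σ v) = M u v)
    (h : ∀ (s : ℕ) (hs : s ≤ k), M.mulVec (eigenvector hs) = 0) : M = 0 := by
  classical
  obtain ⟨g, hg⟩ : ∃ g : ℕ → ℂ, ∀ u v, M u v = g (u.1 \ v.1).card := by
    refine ⟨fun r => if h : ∃ p : JohnsonVertex (2 * k) k × JohnsonVertex (2 * k) k,
      (p.1.1 \ p.2.1).card = r then M h.choose.1 h.choose.2 else 0, fun u v => ?_⟩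
    have hex : ∃ p : JohnsonVertex (2 * k) k × JohnsonVertex (2 * k) k,
      (p.1.1 \ p.2.1).card = (u.1 \ v.1).card := ⟨(u, v), rfl⟩
    simp only
    rw [dif_pos hex]
    obtain ⟨σ, h1, h2⟩ := exists_perm_eq _ _ _ _ hex.choose_spec.symm
    rw [← h1, ← h2, hM]
  obtain ⟨d, hd⟩ := exists_sum_mul_choose_sub k k le_rfl g
  have hMd : ∀ u v, M u v = ∑ j ∈ Finset.range (k + 1),
      d j * ((k - (u.1 \ v.1).card).choose (k - j) : ℂ) := by
    intro u v
    rw [← hd _ (card_sdiff_le u v), if_pos (card_sdiff_le u v), hg]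
  -- The vanishing eigenvalues, indexed by t = k - s, form a homogeneous unitriangular system.
  have hzero : ∀ t ≤ k, ((2 * t).choose t : ℂ) * d t = 0 := by
    intro t ht
    refine AddSubgroup.mem_of_sum_choose_nsmul_mem (⊥ : AddSubgroup ℂ)
      (fun t => ((2 * t).choose t : ℂ) * d t) k (fun t ht => ?_) t ht
    have h1 := mulVec_eigenvector (Nat.sub_le k t) le_rfl d M hMd
    rw [h] at h1
    have h2 := congrFun h1 (initial k)
    rw [Pi.zero_apply, Pi.smul_apply, eigenvector_initial, smul_eq_mul, mul_one,
      show k - (k - t) = t by omega] at h2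
    rw [AddSubgroup.mem_bot, h2]
    refine Finset.sum_congr rfl fun j _ => ?_
    rw [nsmul_eq_mul]
    push_cast
    ring
  have hd0 : ∀ t ≤ k, d t = 0 := fun t ht =>
    (mul_eq_zero.1 (hzero t ht)).resolve_left
      (Nat.cast_ne_zero.2 (Nat.choose_pos (by omega)).ne')
  ext u v
  rw [hMd, Matrix.zero_apply]
  refine Finset.sum_eq_zero fun j hj => ?_
  rw [hd0 j (Finset.mem_range_succ_iff.1 hj), zero_mul]

end JohnsonVertex

/-! ### State transfer as a parity condition. -/

open JohnsonVertex

/-- The eigenvalue of `∑ d_j W_{k-j}ᵀ W_{k-j}` on the eigenspace of `J(2k,k)` of index `k - t`,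
where `W_i` is the inclusion matrix of `i`-subsets in `k`-subsets. -/
def johnsonEigenvalue (m : ℕ) (d : ℕ → ℝ) (t : ℕ) : ℝ :=
  ∑ j ∈ Finset.range (m + 1), d j * ((2 * j).choose j * (t + j).choose (2 * j) : ℕ)

section Transfer

variable {k m : ℕ} {w d : ℕ → ℝ}

theorem quantumWalk_mulVec_eigenvector (hmk : m ≤ k)
    (hd : ∀ u v, johnsonWeightedAdj (2 * k) k m w u v = ∑ j ∈ Finset.range (m + 1),
      d j * ((k - (u.1 \ v.1).card).choose (k - j) : ℝ)) (τ : ℝ) {s : ℕ} (hs : s ≤ k) :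
    (quantumWalk (johnsonWeightedAdj (2 * k) k m w) τ).mulVec (eigenvector hs) =
      Complex.exp (-(Complex.I * τ) * johnsonEigenvalue m d (k - s)) • eigenvector hs := by
  refine Matrix.exp_mulVec_of_mulVec_eq_smul _ _ _ ?_
  rw [Matrix.smul_mulVec, mul_smul]
  congr 1
  rw [mulVec_eigenvector hs hmk (fun j => (d j : ℂ))]
  · congr 1
    simp [johnsonEigenvalue]
  · intro u v
    rw [Matrix.map_apply, hd]
    push_cast
    rfl

theorem exp_neg_I_mul_pi_mul_nat (t : ℕ) :
    Complex.exp (-(Complex.I * (Real.pi * t))) = (-1) ^ t := by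
  rw [show -(Complex.I * ((Real.pi : ℂ) * t)) = t * (-(Real.pi * Complex.I)) by ring,
    Complex.exp_nat_mul, Complex.exp_neg, Complex.exp_pi_mul_I]
  norm_num

/-- By transitivity the row of `initial k` is also supported on its complement. The eigenvector
equation there has the single term c (-1)^s, where c is the transfer amplitude. -/
theorem exists_exp_eq_of_hasPerfectStateTransferAt (hmk : m ≤ k)
    (hd : ∀ u v, johnsonWeightedAdj (2 * k) k m w u v = ∑ j ∈ Finset.range (m + 1),
      d j * ((k - (u.1 \ v.1).card).choose (k - j) : ℝ)) {τ : ℝ}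
    (h : HasPerfectStateTransferAt (johnsonWeightedAdj (2 * k) k m w) τ) :
    ∃ c : ℂ, ∀ s ≤ k,
      Complex.exp (-(Complex.I * τ) * johnsonEigenvalue m d (k - s)) = c * (-1) ^ s := by
  obtain ⟨u, v, huv, h1⟩ := h
  have hv : v = u.compl := Subtype.ext (compl_eq_of_norm_quantumWalk_eq_one huv h1)
  subst hv
  refine ⟨quantumWalk (johnsonWeightedAdj (2 * k) k m w) τ u u.compl, fun s hs => ?_⟩
  obtain ⟨σ, hσ, -⟩ := exists_perm_eq (initial k) (initial k) u u (by simp)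
  have h2 := congrFun (quantumWalk_mulVec_eigenvector hmk hd τ hs) (initial k)
  rw [Pi.smul_apply, eigenvector_initial, smul_eq_mul, mul_one, Matrix.mulVec, dotProduct,
    Finset.sum_eq_single (initial k).compl, eigenvector_compl, eigenvector_initial, mul_one] at h2
  · rw [← h2, ← quantumWalk_johnson_perm _ _ _ _ _ σ, perm_compl, hσ]
  · intro x _ hx
    rw [← quantumWalk_johnson_perm _ _ _ _ _ σ, hσ, quantumWalk_eq_zero_of_norm_eq_one _
      (johnsonWeightedAdj_isSymm _ _ _ _) τ h1, zero_mul]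
    rw [← hσ, ← perm_compl]
    exact (perm σ).injective.ne hx
  · intro hx
    exact absurd (Finset.mem_univ _) hx

/-- U(τ) minus c times the complement matrix K is invariant and kills every eigenvector, so it is
zero; the case s = 0 shows |c| = 1. -/
theorem hasPerfectStateTransferAt_of_exp_eq (hk : 1 ≤ k) (hmk : m ≤ k)
    (hd : ∀ u v, johnsonWeightedAdj (2 * k) k m w u v = ∑ j ∈ Finset.range (m + 1),
      d j * ((k - (u.1 \ v.1).card).choose (k - j) : ℝ)) {τ : ℝ} (c : ℂ)
    (h : ∀ s ≤ k,
      Complex.exp (-(Complex.I * τ) * johnsonEigenvalue m d (k - s)) = c * (-1) ^ s) :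
    HasPerfectStateTransferAt (johnsonWeightedAdj (2 * k) k m w) τ := by
  let K : Matrix (JohnsonVertex (2 * k) k) (JohnsonVertex (2 * k) k) ℂ :=
    Matrix.of fun u v => if v = u.compl then 1 else 0
  have hU : quantumWalk (johnsonWeightedAdj (2 * k) k m w) τ - c • K = 0 := by
    refine eq_zero_of_mulVec_eigenvector _ (fun σ u v => ?_) fun s hs => ?_
    · simp only [K, Matrix.sub_apply, Matrix.smul_apply, Matrix.of_apply,
        quantumWalk_johnson_perm, ← perm_compl, (perm σ).injective.eq_iff]
    · have hK : K.mulVec (eigenvector hs) = (-1 : ℂ) ^ s • eigenvector hs := by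
        ext u
        simp [K, Matrix.mulVec, dotProduct, eigenvector_compl]
      rw [Matrix.sub_mulVec, quantumWalk_mulVec_eigenvector hmk hd τ hs, Matrix.smul_mulVec, hK,
        h s hs, mul_smul, sub_self]
  refine ⟨initial k, (initial k).compl, fun heq => ?_, ?_⟩
  · have h1 : (⟨0, by omega⟩ : Fin (2 * k)) ∈ (initial k).1 := (mem_initial _).2 hk
    have h2 := h1
    rw [heq] at h2
    exact Finset.mem_compl.1 h2 h1
  · have h1 := congrFun (congrFun (sub_eq_zero.1 hU) (initial k)) (initial k).compl
    have hK : K (initial k) (initial k).compl = 1 := if_pos rfl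
    have h2 := h 0 (Nat.zero_le k)
    rw [pow_zero, mul_one] at h2
    rw [h1, Matrix.smul_apply, hK, smul_eq_mul, mul_one, ← h2,
      show -(Complex.I * (τ : ℂ)) * (johnsonEigenvalue m d (k - 0) : ℂ) =
        ((-(τ * johnsonEigenvalue m d (k - 0)) : ℝ) : ℂ) * Complex.I by push_cast; ring,
      Complex.norm_exp_ofReal_mul_I]

/-- Comparison with t = 0, that is s = k, eliminates the unknown phase c. -/
theorem hasPerfectStateTransferAt_iff_eigenvalue (hk : 1 ≤ k) (hmk : m ≤ k)
    (hd : ∀ u v, johnsonWeightedAdj (2 * k) k m w u v = ∑ j ∈ Finset.range (m + 1),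
      d j * ((k - (u.1 \ v.1).card).choose (k - j) : ℝ)) {τ : ℝ} :
    HasPerfectStateTransferAt (johnsonWeightedAdj (2 * k) k m w) τ ↔
      ∀ t ≤ k, ∃ z : ℤ,
        τ * (johnsonEigenvalue m d t - johnsonEigenvalue m d 0) = Real.pi * (t + 2 * z) := by
  constructor
  · intro h t ht
    obtain ⟨c, hc⟩ := exists_exp_eq_of_hasPerfectStateTransferAt hmk hd h
    have h0 := hc k le_rfl
    have h1 := hc (k - t) (Nat.sub_le k t)
    rw [Nat.sub_self] at h0
    rw [show k - (k - t) = t by omega] at h1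
    have h2 : Complex.exp (-(Complex.I * τ) * johnsonEigenvalue m d t) =
        Complex.exp (-(Complex.I * τ) * johnsonEigenvalue m d 0 +
          -(Complex.I * (Real.pi * t))) := by
      rw [Complex.exp_add, exp_neg_I_mul_pi_mul_nat, h0, h1, mul_assoc, ← pow_add]
      congr 1
      rw [show k + t = k - t + 2 * t by omega, pow_add, pow_mul]
      simp
    obtain ⟨z, hz⟩ := Complex.exp_eq_exp_iff_exists_int.1 h2
    refine ⟨-z, ?_⟩
    have h3 : Complex.I * (τ * (johnsonEigenvalue m d t - johnsonEigenvalue m d 0) : ℂ) =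
        Complex.I * (Real.pi * (t + 2 * ((-z : ℤ) : ℂ))) := by
      push_cast
      linear_combination -hz
    have h4 := mul_left_cancel₀ Complex.I_ne_zero h3
    exact_mod_cast h4
  · intro h
    refine hasPerfectStateTransferAt_of_exp_eq hk hmk hd
      (Complex.exp (-(Complex.I * τ) * johnsonEigenvalue m d 0) * (-1) ^ k) fun s hs => ?_
    obtain ⟨z, hz⟩ := h (k - s) (Nat.sub_le k s)
    have hz' : (τ * (johnsonEigenvalue m d (k - s) - johnsonEigenvalue m d 0) : ℂ) =
      Real.pi * ((k - s : ℕ) + 2 * z) := by exact_mod_cast hz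
    have h1 : Complex.exp (-(Complex.I * τ) * johnsonEigenvalue m d (k - s)) =
        Complex.exp (-(Complex.I * τ) * johnsonEigenvalue m d 0 +
          -(Complex.I * (Real.pi * (k - s : ℕ)))) := by
      refine Complex.exp_eq_exp_iff_exists_int.2 ⟨-z, ?_⟩
      push_cast at hz' ⊢
      linear_combination -Complex.I * hz'
    rw [h1, Complex.exp_add, exp_neg_I_mul_pi_mul_nat, mul_assoc, ← pow_add]
    congr 1
    rw [show k + s = k - s + 2 * s by omega, pow_add, pow_mul]
    simp

/-- The j = 0 term is constant in t and cancels. Extending the coefficients by zero up to k makes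
the system square, which later forces the bound on m. -/
theorem mul_johnsonEigenvalue_sub (hmk : m ≤ k) (d : ℕ → ℝ) (τ : ℝ) (t : ℕ) :
    τ * (johnsonEigenvalue m d t - johnsonEigenvalue m d 0) =
      Real.pi * ∑ j ∈ Finset.range (k + 1), (t + j).choose (2 * j) •
        (if 1 ≤ j ∧ j ≤ m then τ / Real.pi * d j * ((2 * j).choose j : ℝ) else 0) := by
  unfold johnsonEigenvalue
  rw [← Finset.sum_sub_distrib, Finset.mul_sum, Finset.mul_sum,
    ← Finset.sum_subset (Finset.range_mono (Nat.succ_le_succ hmk))]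
  · refine Finset.sum_congr rfl fun j hj => ?_
    rcases Nat.eq_zero_or_pos j with rfl | h
    · simp
    · rw [if_pos ⟨h, Finset.mem_range_succ_iff.1 hj⟩,
        Nat.choose_eq_zero_of_lt (by omega : 0 + j < 2 * j), nsmul_eq_mul]
      have := Real.pi_ne_zero
      push_cast
      field_simp
      ring
  · intro j _ hj
    rw [Finset.mem_range_succ_iff] at hj
    rw [if_neg (by omega), smul_zero, mul_zero]

theorem exists_sum_twoPowIndicator_eq {t : ℕ} (ht : t ≤ k) :
    ∃ z : ℤ, ∑ j ∈ Finset.range (k + 1), (t + j).choose (2 * j) • (twoPowIndicator j : ℝ) =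
      t + 2 * z := by
  have h := sum_twoPowIndicator_mul_choose_modEq t
  rw [Finset.sum_subset (Finset.range_mono (Nat.succ_le_succ ht))] at h
  · obtain ⟨z, hz⟩ := (Nat.modEq_iff_dvd.1 h.symm)
    refine ⟨z, ?_⟩
    have hz' := congrArg (Int.cast : ℤ → ℝ) hz
    push_cast at hz'
    simp_rw [nsmul_eq_mul, mul_comm ((Nat.choose _ _ : ℕ) : ℝ)]
    linarith
  · intro j _ hj
    rw [Finset.mem_range] at hj
    rw [Nat.choose_eq_zero_of_lt (by omega), mul_zero]

/-- Subtracting the particular solution leaves a homogeneous system modulo 2ℤ, to which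
unitriangularity applies. -/
theorem hasPerfectStateTransferAt_iff_coeff (hk : 1 ≤ k) (hmk : m ≤ k)
    (hd : ∀ u v, johnsonWeightedAdj (2 * k) k m w u v = ∑ j ∈ Finset.range (m + 1),
      d j * ((k - (u.1 \ v.1).card).choose (k - j) : ℝ)) {τ : ℝ} :
    HasPerfectStateTransferAt (johnsonWeightedAdj (2 * k) k m w) τ ↔
      ∀ j ≤ k, (if 1 ≤ j ∧ j ≤ m then τ / Real.pi * d j * ((2 * j).choose j : ℝ) else 0) -
        (twoPowIndicator j : ℝ) ∈ AddSubgroup.zmultiples (2 : ℝ) := by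
  rw [hasPerfectStateTransferAt_iff_eigenvalue hk hmk hd]
  have key : ∀ t ≤ k, (∃ z : ℤ, τ * (johnsonEigenvalue m d t - johnsonEigenvalue m d 0) =
      Real.pi * (t + 2 * z)) ↔ ∑ j ∈ Finset.range (k + 1), (t + j).choose (2 * j) •
        ((if 1 ≤ j ∧ j ≤ m then τ / Real.pi * d j * ((2 * j).choose j : ℝ) else 0) -
        (twoPowIndicator j : ℝ)) ∈ AddSubgroup.zmultiples (2 : ℝ) := by
    intro t ht
    obtain ⟨y, hy⟩ := exists_sum_twoPowIndicator_eq ht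
    simp_rw [smul_sub]
    rw [Finset.sum_sub_distrib, hy, mul_johnsonEigenvalue_sub hmk, AddSubgroup.mem_zmultiples_iff]
    simp_rw [mul_right_inj' Real.pi_ne_zero, zsmul_eq_mul]
    constructor
    · rintro ⟨z, hz⟩
      refine ⟨z - y, ?_⟩
      rw [hz]
      push_cast
      ring
    · rintro ⟨z, hz⟩
      refine ⟨z + y, ?_⟩
      push_cast
      linarith
  constructor
  · intro h
    exact AddSubgroup.mem_of_sum_choose_nsmul_mem _ _ k fun t ht => (key t ht).1 (h t ht)
  · intro h t ht
    refine (key t ht).2 (AddSubgroup.sum_mem _ fun j hj => ?_)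
    exact AddSubgroup.nsmul_mem _ (h j (Finset.mem_range_succ_iff.1 hj)) _

end Transfer

/-! ### The characterisation. -/

theorem theorem3p6 (n k m : ℕ) (hk : 1 ≤ k) (hmk : m ≤ k) (w : ℕ → ℝ) (τ : ℝ) (hτ : τ ≠ 0) :
    HasPerfectStateTransferAt (johnsonWeightedAdj n k m w) τ ↔
      n = 2 * k ∧ 2 ^ Nat.log 2 k ≤ m ∧
        ∃ c : ℕ → ℤ,
          (∀ j : ℕ, 1 ≤ j → j ≤ m → (Odd (c j) ↔ ∃ a : ℕ, j = 2 ^ a)) ∧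
          (∀ r : ℕ, 1 ≤ r → r ≤ m →
            w r = Real.pi / τ *
              ∑ j ∈ Finset.Icc r m,
                (c j : ℝ) / ((2 * j).choose j : ℝ) * ((k - r).choose (j - r) : ℝ)) := by
  have hπ := Real.pi_ne_zero
  have hchoose : ∀ j : ℕ, ((2 * j).choose j : ℝ) ≠ 0 := fun j =>
    Nat.cast_ne_zero.2 (Nat.choose_pos (by omega)).ne'
  have hlog : 2 ^ Nat.log 2 k ≤ k := Nat.pow_log_le_self 2 (by omega)
  constructor
  · intro h
    have hn : n = 2 * k := by
      obtain ⟨u, v, huv, h1⟩ := h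
      have h2 := congrArg Finset.card (compl_eq_of_norm_quantumWalk_eq_one huv h1)
      have h3 := u.1.card_le_univ
      rw [Finset.card_compl, v.2, u.2, Fintype.card_fin] at h2
      rw [u.2, Fintype.card_fin] at h3
      omega
    subst hn
    obtain ⟨d, hd⟩ := exists_sum_mul_choose_sub k m hmk w
    rw [hasPerfectStateTransferAt_iff_coeff hk hmk fun u v => by
      rw [johnsonWeightedAdj_apply, hd _ (card_sdiff_le u v)]] at h
    refine ⟨rfl, ?_, ?_⟩
    · by_contra hlt
      -- At the largest power of two up to k the coefficient would be 0 and the indicator 1, making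
      -- -1 even.
      obtain ⟨z, hz⟩ := AddSubgroup.mem_zmultiples_iff.1 (h _ hlog)
      rw [if_neg (by omega), twoPowIndicator, if_pos ⟨_, rfl⟩, zsmul_eq_mul] at hz
      have : z * 2 = -1 := by
        have h' : ((z * 2 : ℤ) : ℝ) = ((-1 : ℤ) : ℝ) := by
          push_cast
          push_cast at hz
          linarith
        exact_mod_cast h'
      omega
    · have h' : ∀ j, ∃ z : ℤ, 1 ≤ j ∧ j ≤ m →
          τ / Real.pi * d j * ((2 * j).choose j : ℝ) = twoPowIndicator j + 2 * z := by
        intro j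
        by_cases hj : 1 ≤ j ∧ j ≤ m
        · obtain ⟨z, hz⟩ := AddSubgroup.mem_zmultiples_iff.1 (h j (hj.2.trans hmk))
          rw [if_pos hj, zsmul_eq_mul] at hz
          exact ⟨z, fun _ => by linarith⟩
        · exact ⟨0, fun h => absurd h hj⟩
      choose z hz using h'
      refine ⟨fun j => twoPowIndicator j + 2 * z j, fun j _ _ => ?_, fun r hr hrm => ?_⟩
      · rw [← odd_twoPowIndicator_iff, Int.odd_add]
        simp
      · have h1 := hd r (hrm.trans hmk)
        rw [if_pos hrm, sum_Icc_choose_eq_sum_range hmk d hrm] at h1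
        rw [h1, Finset.mul_sum]
        refine Finset.sum_congr rfl fun j hj => ?_
        rw [Finset.mem_Icc] at hj
        have h2 := hz j ⟨hr.trans hj.1, hj.2⟩
        push_cast
        rw [← h2, ← mul_assoc]
        congr 1
        have := hchoose j
        field_simp
  · rintro ⟨rfl, hm, c, hc, hw⟩
    let f : ℕ → ℝ := fun j => Real.pi / τ * ((c j : ℝ) / ((2 * j).choose j : ℝ))
    -- The condition ignores d 0, so this value is chosen to match the arbitrary weight w 0.
    let d : ℕ → ℝ := Function.update f 0 (w 0 - ∑ j ∈ Finset.Ioc 0 m, f j * (k.choose j : ℝ))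
    have hdf : ∀ j, 1 ≤ j → d j = f j := fun j hj => Function.update_of_ne (by omega) _ _
    rw [hasPerfectStateTransferAt_iff_coeff (d := d) hk hmk]
    · intro j hj
      rw [AddSubgroup.mem_zmultiples_iff]
      split_ifs with hjm
      · have h1 : ∃ z : ℤ, c j - twoPowIndicator j = z * 2 := by
          have h2 : Even (c j - twoPowIndicator j) := by
            rw [Int.even_sub', hc j hjm.1 hjm.2, ← odd_twoPowIndicator_iff, Int.odd_coe_nat]
          obtain ⟨z, hz⟩ := h2
          exact ⟨z, by omega⟩
        obtain ⟨z, hz⟩ := h1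
        refine ⟨z, ?_⟩
        have hz' := congrArg (Int.cast : ℤ → ℝ) hz
        push_cast at hz'
        rw [zsmul_eq_mul, ← hz', hdf j hjm.1]
        congr 1
        have := hchoose j
        simp only [f]
        field_simp
      · refine ⟨0, ?_⟩
        have h1 : twoPowIndicator j = 0 := by
          rcases Nat.eq_zero_or_pos j with rfl | hpos
          · exact twoPowIndicator_zero
          · refine if_neg ?_
            rintro ⟨a, rfl⟩
            refine hjm ⟨hpos, le_trans ?_ hm⟩
            exact Nat.pow_le_pow_right two_pos (Nat.le_log_of_pow_le one_lt_two hj)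
        rw [h1]
        simp
    · intro u v
      rw [johnsonWeightedAdj_apply]
      have hrk := card_sdiff_le u v
      generalize (u.1 \ v.1).card = r at hrk ⊢
      split_ifs with hr
      · rw [sum_Icc_choose_eq_sum_range hmk d hr]
        rcases Nat.eq_zero_or_pos r with rfl | hpos
        · have h1 : ∑ j ∈ Finset.Ioc 0 m, d j * ((k - 0).choose (j - 0) : ℝ) =
              ∑ j ∈ Finset.Ioc 0 m, f j * (k.choose j : ℝ) :=
            Finset.sum_congr rfl fun j hj => by rw [hdf j (Finset.mem_Ioc.1 hj).1]; rfl
          rw [← Finset.add_sum_Ioc_eq_sum_Icc (Nat.zero_le m), h1]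
          simp [d]
        · rw [hw r hpos hr, Finset.mul_sum]
          refine Finset.sum_congr rfl fun j hj => ?_
          rw [hdf j (hpos.trans_le (Finset.mem_Icc.1 hj).1), ← mul_assoc]
      · symm
        refine Finset.sum_eq_zero fun j hj => ?_
        rw [Finset.mem_range] at hj
        rw [Nat.choose_eq_zero_of_lt (by omega)]
        simp
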